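/- Let $\mathbb{N}_2$ be the set of unordered pairs $e=\{i,j\}$ of distinct natural numbers and let $\mu$ be a finite measure on $\mathbb{N}_2$ (for instance a probability measure). Write $\mu_e=\mu(\{e\})$, $\mu_{ij}=\mu_{\{i,j\}}$ for $i\ne j$, $\mu_{ii}=0$, and $M_i=\sum_{j}\mu_{ij}$. Let $(N_e)_{e\in\mathbb{N}_2}$ be independent Poisson processes on $[0,\infty)$, $N_e$ having intensity $\mu_e$. For $t\ge 0$ let $G_t$ be the random graph (parallel edges identified) whose edges are the $e$ with $N_e(t)\ge 1$ and whose vertex set $V_t$ is the set of endpoints of these edges. Let $(B_i)_{i\in\mathbb{N}}$ be independent Poisson processes, $B_i$ having intensity $M_i$ (possibly defined on another probability space), and let $U_t=\{i: B_i(t)\ge 1\}$ be the set of occupied urns at time $t$. Suppose that $G_t$ is eventually forever connected, i.e. that almost surely there is a (random) time $T$ such that $G_t$ is connected for every $t>T$. If at least one of $\mathbb{V}[|U_t|]$ and $\mathbb{V}[|V_t|]$ tends to infinity as $t\to\infty$, then so does the other, and $$\frac{\mathbb{V}[|V_t|]}{\mathbb{V}[|U_t|]}\longrightarrow 1\qquad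 (t\to\infty).$$ -/

import Mathlib

open MeasureTheory ProbabilityTheory Filter Topology
open scoped NNReal ENNReal

namespace EdgeExchangeable

/-- The set `ℕ₂` of unordered pairs of distinct natural numbers: the potential edges. -/
abbrev Edge : Type := {e : Sym2 ℕ // ¬ e.IsDiag}

/-- The discrete σ-algebra on the countable set of potential edges. -/
instance instMeasurableSpaceEdge : MeasurableSpace Edge := ⊤

/-- The intensity `μ_e = μ({e})` of the edge `e`. -/
noncomputable def edgeRate (μ : Measure Edge) (e : Edge) : ℝ≥0 :=
  (μ {e}).toNNReal

/-- The mass `μ_{ij} = μ({{i, j}})`. It vanishes for `i = j`, since no element of `Edge` is then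
equal to `s(i, j)`. -/
noncomputable def pairMass (μ : Measure Edge) (i j : ℕ) : ℝ≥0∞ :=
  μ {e : Edge | (e : Sym2 ℕ) = s(i, j)}

/-- The total intensity `M_i = ∑_j μ_{ij}` of the vertex `i` (finite when `μ` is finite). -/
noncomputable def vertexRate (μ : Measure Edge) (i : ℕ) : ℝ≥0 :=
  (∑' j, pairMass μ i j).toNNReal

/-- `N` is a (homogeneous) Poisson process of intensity `r` on `[0, ∞)` under `P`: a counting
process started at `0` whose paths are nondecreasing and right-continuous, with independent
increments, the increment over `(s, t]` being Poisson with mean `r (t - s)`.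
Sample path properties are required almost surely. As the paths are almost surely nondecreasing,
the natural-number subtraction in the increments does not truncate (almost surely).
Intensity `0` is allowed. -/
structure IsPoissonProcess {Ω : Type*} [MeasurableSpace Ω]
    (N : ℝ≥0 → Ω → ℕ) (r : ℝ≥0) (P : Measure Ω) : Prop where
  measurable : ∀ t, Measurable (N t)
  start_zero : ∀ᵐ ω ∂P, N 0 ω = 0
  monotone_path : ∀ᵐ ω ∂P, Monotone fun t => N t ω
  rightCts_path : ∀ᵐ ω ∂P, ∀ t, ContinuousWithinAt (fun s => N s ω) (Set.Ici t) t
  indep_increments : HasIndepIncrements N P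
  law_increments : ∀ s t : ℝ≥0, s ≤ t →
    HasLaw (fun ω => N t ω - N s ω) (poissonMeasure (r * (t - s))) P

/-- A family of independent Poisson processes `N i` with intensities `r i`; independence is that of
the whole processes. -/
structure IsIndepPoissonFamily {ι Ω : Type*} [MeasurableSpace Ω]
    (N : ι → ℝ≥0 → Ω → ℕ) (r : ι → ℝ≥0) (P : Measure Ω) : Prop where
  poisson : ∀ i, IsPoissonProcess (N i) (r i) P
  indep : iIndepFun (fun i ω t => N i t ω) P

section Graph

variable {Ω : Type*}

/-- The set of edges that are present at time `t`, i.e. the edges of `G_t` after identifying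
parallel edges; `N e t ω` is the number of parallel copies of `e`. -/
def edgesAt (N : Edge → ℝ≥0 → Ω → ℕ) (t : ℝ≥0) (ω : Ω) : Set Edge :=
  {e | 0 < N e t ω}

/-- The vertex set `V_t`: the endpoints of the edges that are present at time `t`. -/
def verticesAt (N : Edge → ℝ≥0 → Ω → ℕ) (t : ℝ≥0) (ω : Ω) : Set ℕ :=
  {v | ∃ e ∈ edgesAt N t ω, v ∈ (e : Sym2 ℕ)}

/-- The random graph `G_t = (V_t, E_t)` (parallel edges identified), as a graph on a subset of
`ℕ`. -/
def graphAt (N : Edge → ℝ≥0 → Ω → ℕ) (t : ℝ≥0) (ω : Ω) : (⊤ : SimpleGraph ℕ).Subgraph where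
  verts := verticesAt N t ω
  Adj u v := ∃ e ∈ edgesAt N t ω, (e : Sym2 ℕ) = s(u, v)
  adj_sub := by
    rintro u v ⟨e, -, he⟩
    have hd := e.2
    rw [he, Sym2.mk_isDiag_iff] at hd
    exact hd
  edge_vert := by
    rintro u v ⟨e, hmem, he⟩
    exact ⟨e, hmem, he ▸ Sym2.mem_mk_left u v⟩
  symm := ⟨by
    rintro u v ⟨e, hmem, he⟩
    exact ⟨e, hmem, he.trans Sym2.eq_swap⟩⟩

end Graph

/-- The set `U_t` of occupied urns at time `t`, where `N i t ω` is the number of balls in urn `i`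
at time `t`. -/
def occupiedUrns {Ω : Type*} (N : ℕ → ℝ≥0 → Ω → ℕ) (t : ℝ≥0) (ω : Ω) : Set ℕ :=
  {i | 0 < N i t ω}

/-- The process `X` has the property `A` eventually forever, almost surely: for almost every `ω`
there is an index `i` such that `A (X j ω)` for all `j > i`. -/
def EventuallyForever {Ω I 𝒳 : Type*} [MeasurableSpace Ω] [Preorder I]
    (X : I → Ω → 𝒳) (A : 𝒳 → Prop) (P : Measure Ω) : Prop :=
  ∀ᵐ ω ∂P, ∃ i, ∀ j, i < j → A (X j ω)

/-- The variance of the cardinality of the random set `S`. (For the vertex sets and the sets of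
occupied urns above, `S` is almost surely finite, so that `Set.ncard` is the cardinality.) -/
noncomputable def cardVariance {Ω : Type*} [MeasurableSpace Ω]
    (S : Ω → Set ℕ) (P : Measure Ω) : ℝ :=
  variance (fun ω => ((S ω).ncard : ℝ)) P

end EdgeExchangeable

/-! A vertex is present with the same probability as its urn is occupied, and urns are independent,
so $\mathbb{V}[|V_t|]-\mathbb{V}[|U_t|]$ is the sum over ordered pairs $i\ne j$ of the covariances
of "$i\in V_t$" and "$j\in V_t$". These are nonnegative, so it suffices to bound their sum uniformly
in $t$. Write $a_e$ for the total intensity of the edges meeting $e$. The covariance attached to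
$e=\{i,j\}$ is at most $\mu_e/a_e$ at every time (`vertexCov_le`), so everything reduces to
$\sum_e\mu_e/a_e<\infty$ (`summable_isolation`). This is where connectivity enters. At time $1/a_e$
the edge $e$ is present and isolated with probability at least $e^{-1}\mu_e/a_e$, while it is
present at all with probability at most $\mu_e/a_e$. Since distinct edges are independent, these
isolation events are pairwise independent up to the factor $e^2$, and by a Kochen–Stone argument a
divergent sum would make infinitely many of them occur with positive probability. Infinitely many
isolations would happen at arbitrarily late times, next to an edge already present, contradicting
eventual connectedness (`ae_finite_isolatedEvent`). -/

namespace EdgeExchangeable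

/-! ### A converse Borel–Cantelli lemma under quasi-independence. -/

section BorelCantelli

variable {Ω : Type*} [MeasurableSpace Ω]

/-- Events that are pairwise independent up to a constant, and only finitely many of which occur
almost surely, have summable probabilities (a form of the Kochen–Stone lemma). -/
theorem summable_measureReal_of_quasiIndep {ι : Type*} [Countable ι] (P : Measure Ω)
    [IsProbabilityMeasure P] {F : ι → Set Ω} (hF : ∀ i, MeasurableSet (F i)) {c : ℝ} (hc : 0 ≤ c)
    (hquasi : ∀ i j, i ≠ j → P.real (F i ∩ F j) ≤ c * (P.real (F i) * P.real (F j)))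
    (hfin : ∀ᵐ ω ∂P, {i | ω ∈ F i}.Finite) :
    Summable fun i => P.real (F i) := by
  classical
  -- `X S` counts the events indexed by `S` that occur.
  set X : Finset ι → Ω → ℝ := fun S ω => ∑ i ∈ S, (F i).indicator (fun _ => (1 : ℝ)) ω with hX
  have hXint : ∀ S, Integrable (X S) P := fun S =>
    integrable_finsetSum _ fun i _ => (integrable_const 1).indicator (hF i)
  have hXmean : ∀ S, ∫ ω, X S ω ∂P = ∑ i ∈ S, P.real (F i) := by
    intro S
    rw [integral_finsetSum _ fun i _ => (integrable_const 1).indicator (hF i)]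
    exact Finset.sum_congr rfl fun i _ => by
      rw [integral_indicator (hF i)]; simp
  have hsq : ∀ S ω, X S ω ^ 2
      = ∑ i ∈ S, ∑ j ∈ S, (F i ∩ F j).indicator (fun _ => (1 : ℝ)) ω := by
    intro S ω
    simp only [hX, sq, Finset.sum_mul_sum]
    refine Finset.sum_congr rfl fun i _ => Finset.sum_congr rfl fun j _ => ?_
    by_cases h1 : ω ∈ F i <;> by_cases h2 : ω ∈ F j <;> simp [h1, h2]
  have hij : ∀ i j, Integrable ((F i ∩ F j).indicator fun _ => (1 : ℝ)) P := fun i j =>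
    (integrable_const 1).indicator ((hF i).inter (hF j))
  have hXsqint : ∀ S, Integrable (fun ω => X S ω ^ 2) P := by
    intro S
    simp only [hsq]
    exact integrable_finsetSum _ fun i _ => integrable_finsetSum _ fun j _ => hij i j
  have hXsq : ∀ S, ∫ ω, X S ω ^ 2 ∂P
      ≤ (∑ i ∈ S, P.real (F i)) + c * (∑ i ∈ S, P.real (F i)) ^ 2 := by
    intro S
    simp only [hsq]
    rw [integral_finsetSum _ fun i _ => integrable_finsetSum _ fun j _ => hij i j]
    rw [sq, Finset.sum_mul_sum, Finset.mul_sum, ← Finset.sum_add_distrib]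
    refine Finset.sum_le_sum fun i hi => ?_
    rw [integral_finsetSum _ fun j _ => hij i j]
    have : P.real (F i) = ∑ j ∈ S, if i = j then P.real (F i) else 0 := by
      rw [Finset.sum_ite_eq]; simp [hi]
    rw [Finset.mul_sum]
    nth_rw 1 [this]
    rw [← Finset.sum_add_distrib]
    refine Finset.sum_le_sum fun j _ => ?_
    rw [integral_indicator ((hF i).inter (hF j))]
    simp only [integral_const, MeasurableSet.univ, measureReal_restrict_apply, Set.univ_inter,
      smul_eq_mul, mul_one]
    split_ifs with h
    · subst h
      have : 0 ≤ c * (P.real (F i) * P.real (F i)) := by positivity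
      simpa using this
    · simpa using hquasi i j h
  -- With high probability at most `K` events occur.
  set δ : ℝ := 1 / (2 * (1 + c)) with hδ
  have hδ0 : 0 < δ := by positivity
  set A : ℕ → Set Ω := fun K => ⋃ S : Finset ι, {ω | (K : ℝ) < X S ω} with hA
  have hAmeas : ∀ K, MeasurableSet (A K) := fun K => MeasurableSet.iUnion fun S =>
    measurableSet_lt measurable_const
      (Finset.measurable_sum _ fun i _ => measurable_const.indicator (hF i))
  have hAanti : Antitone A := by
    intro K L hKL ω hω
    simp only [hA, Set.mem_iUnion, Set.mem_ofPred_eq] at hω ⊢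
    obtain ⟨S, hS⟩ := hω
    exact ⟨S, lt_of_le_of_lt (by exact_mod_cast hKL) hS⟩
  have hAnull : P (⋂ K, A K) = 0 := by
    refine measure_mono_null ?_ hfin
    intro ω hω hfinω
    have hbd : ∀ S, X S ω ≤ hfinω.toFinset.card := by
      intro S
      simp only [hX, Set.indicator_apply, Finset.sum_ite, Finset.sum_const, nsmul_eq_mul, mul_one, add_zero, mul_zero]
      exact_mod_cast Finset.card_le_card fun i hi => by simpa using (Finset.mem_filter.1 hi).2
    have := Set.mem_iInter.1 hω hfinω.toFinset.card
    simp only [hA, Set.mem_iUnion, Set.mem_ofPred_eq] at this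
    obtain ⟨S, hS⟩ := this
    exact absurd hS (not_lt.2 (hbd S))
  have hAlim : Tendsto (fun K => P (A K)) atTop (𝓝 0) := by
    rw [← hAnull]
    exact tendsto_measure_iInter_atTop (fun K => (hAmeas K).nullMeasurableSet) hAanti
      ⟨0, measure_ne_top _ _⟩
  obtain ⟨K, hK⟩ : ∃ K, P.real (A K) < δ := by
    have := (ENNReal.tendsto_toReal ENNReal.zero_ne_top).comp hAlim
    exact (this.eventually (gt_mem_nhds (by simpa using hδ0))).exists
  refine summable_of_sum_le (c := max 1 (4 * K)) (fun i => measureReal_nonneg) fun S => ?_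
  set s := ∑ i ∈ S, P.real (F i) with hs
  rcases le_or_gt s 1 with h1 | h1
  · exact h1.trans (le_max_left _ _)
  refine le_trans ?_ (le_max_right _ _)
  -- For `s > 1` the second moment is at most `s ^ 2 * (1 + c)`, so this `l` makes the quadratic
  -- term below cost at most `s / 2`. The choice of `δ` makes the remaining term at most `s / 4`,
  -- which leaves `s / 4 ≤ K`.
  set l : ℝ := 1 / (s * (1 + c)) with hl
  have hl0 : 0 < l := by positivity
  -- Off `A K` the count is at most `K`; on `A K` this is the weighted inequality $x\le l
  -- x^2/2+1/(2l)$.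
  have hpt : ∀ ω, X S ω ≤ K + (l / 2 * X S ω ^ 2
      + (A K).indicator (fun _ => 1 / (2 * l)) ω) := by
    intro ω
    by_cases hω : ω ∈ A K
    · rw [Set.indicator_of_mem hω]
      have hsq : 0 ≤ (l * X S ω - 1) ^ 2 / (2 * l) := by positivity
      have : (l * X S ω - 1) ^ 2 / (2 * l) = l / 2 * X S ω ^ 2 + 1 / (2 * l) - X S ω := by
        field_simp; ring
      have hK0 : (0 : ℝ) ≤ K := Nat.cast_nonneg K
      linarith
    · rw [Set.indicator_of_notMem hω]
      have : X S ω ≤ K := not_lt.1 fun h => hω (Set.mem_iUnion.2 ⟨S, h⟩)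
      have : 0 ≤ l / 2 * X S ω ^ 2 := by positivity
      linarith
  have hi2 : Integrable ((A K).indicator fun _ => 1 / (2 * l)) P :=
    (integrable_const _).indicator (hAmeas K)
  have hint := integral_mono (hXint S)
    ((integrable_const (K : ℝ)).add (((hXsqint S).const_mul (l / 2)).add hi2)) hpt
  rw [hXmean, integral_add' (integrable_const _) (((hXsqint S).const_mul _).add hi2),
    integral_add' ((hXsqint S).const_mul _) hi2, integral_const_mul,
    integral_indicator (hAmeas K)] at hint
  simp only [integral_const, MeasurableSet.univ, measureReal_restrict_apply, Set.univ_inter,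
    smul_eq_mul, probReal_univ, one_mul] at hint
  have h2 : l / 2 * ∫ ω, X S ω ^ 2 ∂P ≤ s / 2 := by
    calc l / 2 * ∫ ω, X S ω ^ 2 ∂P ≤ l / 2 * (s + c * s ^ 2) := by gcongr; exact hXsq S
      _ ≤ l / 2 * (s ^ 2 * (1 + c)) := by gcongr; nlinarith
      _ = s / 2 := by rw [hl]; field_simp
  have h3 : P.real (A K) * (1 / (2 * l)) ≤ s / 4 := by
    calc P.real (A K) * (1 / (2 * l)) ≤ δ * (1 / (2 * l)) := by gcongr
      _ = s / 4 := by rw [hδ, hl]; field_simp; norm_num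
  linarith

end BorelCantelli

/-! ### Moments of the cardinality of a random set. -/

section Moments

variable {Ω : Type*} [MeasurableSpace Ω] (P : Measure Ω) {S : Ω → Set ℕ}

/-- By the first Borel–Cantelli lemma the set is almost surely finite, which excludes the default
value `0` of `Set.ncard` on infinite sets. -/
theorem ae_ncard_eq_tsum_indicator (hsum : ∑' i, P {ω | i ∈ S ω} ≠ ∞) :
    ∀ᵐ ω ∂P, ((S ω).ncard : ℝ≥0∞) = ∑' i, {ω | i ∈ S ω}.indicator (fun _ => 1) ω := by
  filter_upwards [ae_finite_setOfPred_mem hsum] with ω hω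
  have hω' : (S ω).Finite := hω
  rw [show (∑' i, {ω | i ∈ S ω}.indicator (fun _ => (1 : ℝ≥0∞)) ω)
    = ∑' i, (S ω).indicator (fun _ => (1 : ℝ≥0∞)) i from rfl, ← tsum_subtype]
  simp [← hω'.cast_ncard_eq]

theorem lintegral_ncard (hS : ∀ i, MeasurableSet {ω | i ∈ S ω})
    (hsum : ∑' i, P {ω | i ∈ S ω} ≠ ∞) :
    ∫⁻ ω, ((S ω).ncard : ℝ≥0∞) ∂P = ∑' i, P {ω | i ∈ S ω} := by
  rw [lintegral_congr_ae (ae_ncard_eq_tsum_indicator P hsum),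
    lintegral_tsum fun i => (measurable_const.indicator (hS i)).aemeasurable]
  simp [lintegral_indicator (hS _)]

theorem lintegral_ncard_sq (hS : ∀ i, MeasurableSet {ω | i ∈ S ω})
    (hsum : ∑' i, P {ω | i ∈ S ω} ≠ ∞) :
    ∫⁻ ω, ((S ω).ncard : ℝ≥0∞) ^ 2 ∂P
      = ∑' i, ∑' j, P ({ω | i ∈ S ω} ∩ {ω | j ∈ S ω}) := by
  have h : ∀ᵐ ω ∂P, ((S ω).ncard : ℝ≥0∞) ^ 2
      = ∑' i, ∑' j, ({ω | i ∈ S ω} ∩ {ω | j ∈ S ω}).indicator (fun _ => 1) ω := by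
    filter_upwards [ae_ncard_eq_tsum_indicator P hsum] with ω hω
    rw [hω, sq, ← ENNReal.tsum_mul_right]
    refine tsum_congr fun i => ?_
    rw [← ENNReal.tsum_mul_left]
    refine tsum_congr fun j => ?_
    by_cases h1 : i ∈ S ω <;> by_cases h2 : j ∈ S ω <;> simp [h1, h2]
  rw [lintegral_congr_ae h, lintegral_tsum fun i => (Measurable.tsum fun j =>
    measurable_const.indicator ((hS i).inter (hS j))).aemeasurable]
  refine tsum_congr fun i => ?_
  rw [lintegral_tsum fun j => (measurable_const.indicator ((hS i).inter (hS j))).aemeasurable]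
  simp [lintegral_indicator ((hS _).inter (hS _))]

theorem aemeasurable_ncard (hS : ∀ i, MeasurableSet {ω | i ∈ S ω})
    (hsum : ∑' i, P {ω | i ∈ S ω} ≠ ∞) :
    AEMeasurable (fun ω => ((S ω).ncard : ℝ)) P := by
  have : AEMeasurable (fun ω => ((S ω).ncard : ℝ≥0∞)) P :=
    (Measurable.tsum fun i => measurable_const.indicator (hS i)).aemeasurable.congr
      ((ae_ncard_eq_tsum_indicator P hsum).mono fun _ h => h.symm)
  simpa using this.ennreal_toReal

/-- The variance of the cardinality of a random set, in terms of its one- and two-point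
inclusion probabilities. -/
theorem cardVariance_eq [IsProbabilityMeasure P] (hS : ∀ i, MeasurableSet {ω | i ∈ S ω})
    (hsum : ∑' i, P {ω | i ∈ S ω} ≠ ∞)
    (hsum2 : ∑' i, ∑' j, P ({ω | i ∈ S ω} ∩ {ω | j ∈ S ω}) ≠ ∞) :
    cardVariance S P = (∑' i, ∑' j, P ({ω | i ∈ S ω} ∩ {ω | j ∈ S ω})).toReal
      - (∑' i, P {ω | i ∈ S ω}).toReal ^ 2 := by
  have hm := aemeasurable_ncard P hS hsum
  have hL2 : MemLp (fun ω => ((S ω).ncard : ℝ)) 2 P := by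
    refine ⟨hm.aestronglyMeasurable, ?_⟩
    rw [eLpNorm_lt_top_iff_lintegral_rpow_enorm_lt_top (by norm_num) (by norm_num)]
    have : ∀ ω, ‖((S ω).ncard : ℝ)‖ₑ ^ (2 : ℝ≥0∞).toReal = ((S ω).ncard : ℝ≥0∞) ^ 2 := by
      intro ω; simp
    simp only [this]
    rw [lintegral_ncard_sq P hS hsum]
    exact hsum2.lt_top
  rw [cardVariance, variance_eq_sub hL2]
  simp only [Pi.pow_apply]
  rw [← lintegral_ncard P hS hsum,
    ← lintegral_ncard_sq P hS hsum, integral_eq_lintegral_of_nonneg_ae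
      (ae_of_all _ fun ω => by positivity) hm.aestronglyMeasurable,
    integral_eq_lintegral_of_nonneg_ae
      (ae_of_all _ fun ω => by positivity) (hm.pow_const 2).aestronglyMeasurable]
  simp

end Moments

end EdgeExchangeable

namespace EdgeExchangeable

/-! ### Void probabilities for finitely many Poisson processes. -/

section Poisson

variable {Ω : Type*} [MeasurableSpace Ω] {P : Measure Ω}

theorem IsPoissonProcess.measureReal_eq_zero {N : ℝ≥0 → Ω → ℕ} {r : ℝ≥0}
    (hN : IsPoissonProcess N r P) (t : ℝ≥0) :
    P.real {ω | N t ω = 0} = Real.exp (-(r * t)) := by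
  have h1 : {ω | N t ω = 0} =ᵐ[P] (fun ω => N t ω - N 0 ω) ⁻¹' {0} := by
    filter_upwards [hN.start_zero] with ω hω
    change (N t ω = 0) = (N t ω - N 0 ω = 0)
    rw [hω, Nat.sub_zero]
  have hlaw := hN.law_increments 0 t zero_le
  rw [measureReal_congr h1, ← map_measureReal_apply_of_aemeasurable hlaw.aemeasurable
    (measurableSet_singleton 0), hlaw.map_eq, poissonMeasure_real_singleton]
  simp

variable {ι : Type*} {N : ι → ℝ≥0 → Ω → ℕ} {r : ι → ℝ≥0}

theorem measurableSet_forall_eq_zero [Countable ι] (hN : IsIndepPoissonFamily N r P)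
    (A : Set ι) (t : ℝ≥0) : MeasurableSet {ω | ∀ i ∈ A, N i t ω = 0} := by
  simp only [Set.ofPred_forall]
  exact MeasurableSet.iInter fun i => MeasurableSet.iInter fun _ =>
    (hN.poisson i).measurable t (measurableSet_singleton 0)

theorem measureReal_pos [IsProbabilityMeasure P] (hN : IsIndepPoissonFamily N r P)
    (i : ι) (t : ℝ≥0) :
    P.real {ω | 0 < N i t ω} = 1 - Real.exp (-(r i * t)) := by
  have h : {ω | 0 < N i t ω} = {ω | N i t ω = 0}ᶜ := by
    ext ω; simp [Nat.pos_iff_ne_zero]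
  have hm : MeasurableSet {ω | N i t ω = 0} :=
    (hN.poisson i).measurable t (measurableSet_singleton 0)
  rw [h, probReal_compl_eq_one_sub hm,
    (hN.poisson i).measureReal_eq_zero]

theorem measureReal_pos_inter (hN : IsIndepPoissonFamily N r P)
    {i j : ι} (hij : i ≠ j) (s t : ℝ≥0) :
    P.real ({ω | 0 < N i s ω} ∩ {ω | 0 < N j t ω})
      = P.real {ω | 0 < N i s ω} * P.real {ω | 0 < N j t ω} := by
  have hm : ∀ s : ℝ≥0, MeasurableSet {x : ℝ≥0 → ℕ | 0 < x s} := fun s =>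
    measurableSet_lt measurable_const (measurable_pi_apply s)
  have := (hN.indep.indepFun hij).measure_inter_preimage_eq_mul _ _ (hm s) (hm t)
  simp only [measureReal_def, ← ENNReal.toReal_mul]
  exact congrArg _ this

theorem measureReal_forall_finset_eq_zero (hN : IsIndepPoissonFamily N r P)
    (S : Finset ι) (t : ℝ≥0) :
    P.real {ω | ∀ i ∈ S, N i t ω = 0} = Real.exp (-((∑ i ∈ S, (r i : ℝ)) * t)) := by
  have hm : MeasurableSet {x : ℝ≥0 → ℕ | x t = 0} :=
    measurable_pi_apply t (measurableSet_singleton 0)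
  have h := hN.indep.measure_inter_preimage_eq_mul S (sets := fun _ => {x | x t = 0})
    (fun _ _ => hm)
  have hset : {ω | ∀ i ∈ S, N i t ω = 0}
      = ⋂ i ∈ S, (fun ω t => N i t ω) ⁻¹' {x : ℝ≥0 → ℕ | x t = 0} := by
    ext ω; simp
  rw [measureReal_def, hset, h, ENNReal.toReal_prod, Finset.sum_mul, ← Finset.sum_neg_distrib,
    Real.exp_sum]
  exact Finset.prod_congr rfl fun i _ => (hN.poisson i).measureReal_eq_zero t

end Poisson

/-! ### Void probabilities for arbitrary sets of edges. -/

section Void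

instance : Countable Edge := inferInstanceAs (Countable {e : Sym2 ℕ // ¬ e.IsDiag})

variable {Ω : Type*} [MeasurableSpace Ω] {P : Measure Ω} [IsProbabilityMeasure P]
  {μ : Measure Edge} [IsFiniteMeasure μ] {N : Edge → ℝ≥0 → Ω → ℕ}

/-- The probability that no edge of `A` is present at time `t`. -/
theorem measureReal_forall_eq_zero (hN : IsIndepPoissonFamily N (edgeRate μ) P)
    (A : Set Edge) (t : ℝ≥0) :
    P.real {ω | ∀ e ∈ A, N e t ω = 0} = Real.exp (-(μ.real A * t)) := by
  classical
  -- Independence gives the formula for finite sets; an enumeration exhausts `A` by such sets, and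
  -- both sides pass to the limit by continuity of measures.
  obtain ⟨f, hf⟩ := exists_injective_nat Edge
  have hfin : ∀ n, (f ⁻¹' Set.Iio n).Finite := fun n =>
    (Set.finite_Iio n).preimage hf.injOn
  have hfin' : ∀ n, (A ∩ f ⁻¹' Set.Iio n).Finite := fun n => (hfin n).inter_of_right A
  have hmono : Monotone fun n => A ∩ f ⁻¹' Set.Iio n := fun m n hmn =>
    Set.inter_subset_inter_right _ (Set.preimage_mono (Set.Iio_subset_Iio hmn))
  have hunion : ⋃ n, A ∩ f ⁻¹' Set.Iio n = A := by
    ext e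
    simp only [Set.mem_iUnion, Set.mem_inter_iff, Set.mem_preimage, Set.mem_Iio]
    exact ⟨fun ⟨_, h, _⟩ => h, fun h => ⟨f e + 1, h, Nat.lt_succ_self _⟩⟩
  have hlim1 : Tendsto (fun n => μ.real (A ∩ f ⁻¹' Set.Iio n)) atTop (𝓝 (μ.real A)) := by
    have := tendsto_measure_iUnion_atTop (μ := μ) hmono
    rw [hunion] at this
    exact (ENNReal.tendsto_toReal (measure_ne_top _ _)).comp this
  have hlim2 : Tendsto (fun n => P.real {ω | ∀ e ∈ A ∩ f ⁻¹' Set.Iio n, N e t ω = 0}) atTop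
      (𝓝 (P.real {ω | ∀ e ∈ A, N e t ω = 0})) := by
    have hinter : ⋂ n, {ω | ∀ e ∈ A ∩ f ⁻¹' Set.Iio n, N e t ω = 0}
        = {ω | ∀ e ∈ A, N e t ω = 0} := by
      ext ω
      simp only [Set.mem_iInter, Set.mem_ofPred_eq]
      refine ⟨fun h e he => ?_, fun h n e he => h e he.1⟩
      exact h (f e + 1) e ⟨he, Nat.lt_succ_self _⟩
    have := tendsto_measure_iInter_atTop (μ := P)
      (s := fun n => {ω | ∀ e ∈ A ∩ f ⁻¹' Set.Iio n, N e t ω = 0})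
      (fun n => (measurableSet_forall_eq_zero hN _ t).nullMeasurableSet)
      (fun m n hmn ω hω e he => hω e (hmono hmn he)) ⟨0, measure_ne_top _ _⟩
    rw [hinter] at this
    exact (ENNReal.tendsto_toReal (measure_ne_top _ _)).comp this
  have heq : ∀ n, P.real {ω | ∀ e ∈ A ∩ f ⁻¹' Set.Iio n, N e t ω = 0}
      = Real.exp (-(μ.real (A ∩ f ⁻¹' Set.Iio n) * t)) := by
    intro n
    have h := measureReal_forall_finset_eq_zero hN (hfin' n).toFinset t
    simp only [Set.Finite.mem_toFinset] at h
    rw [h]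
    congr 3
    rw [show (∑ e ∈ (hfin' n).toFinset, (edgeRate μ e : ℝ))
      = ∑ e ∈ (hfin' n).toFinset, μ.real {e} from rfl,
      sum_measureReal_singleton, Set.Finite.coe_toFinset]
  refine tendsto_nhds_unique hlim2 ?_
  simp only [heq]
  exact (Real.continuous_exp.tendsto _).comp (hlim1.mul_const _).neg

/-- The probability that `e` is present and that no edge of `A` is. -/
theorem measureReal_pos_inter_forall_eq_zero (hN : IsIndepPoissonFamily N (edgeRate μ) P)
    (e : Edge) (A : Set Edge) (t : ℝ≥0) :
    P.real ({ω | 0 < N e t ω} ∩ {ω | ∀ f ∈ A, N f t ω = 0})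
      = Real.exp (-(μ.real A * t)) - Real.exp (-(μ.real (insert e A) * t)) := by
  rw [← measureReal_forall_eq_zero hN A, ← measureReal_forall_eq_zero hN (insert e A),
    ← measureReal_sdiff (s₁ := {ω | ∀ f ∈ A, N f t ω = 0})
      (s₂ := {ω | ∀ f ∈ insert e A, N f t ω = 0})
      (fun ω hω f hf => hω f (Set.mem_insert_of_mem _ hf))
      (measurableSet_forall_eq_zero hN _ t)]
  congr 1
  ext ω
  simp only [Set.mem_inter_iff, Set.mem_ofPred_eq, Set.mem_sdiff, Set.forall_mem_insert, not_and]
  constructor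
  · rintro ⟨h1, h2⟩
    exact ⟨h2, fun h => absurd h h1.ne'⟩
  · rintro ⟨h1, h2⟩
    exact ⟨Nat.pos_of_ne_zero fun h => h2 h h1, h1⟩

end Void

end EdgeExchangeable

namespace EdgeExchangeable

/-! ### Edges that appear in isolation. -/

section Isolation

/-- The edges that contain the vertex `i`. -/
def star (i : ℕ) : Set Edge := {e | i ∈ (e : Sym2 ℕ)}

/-- The edges that share a vertex with `e` (among them `e` itself). -/
def touching (e : Edge) : Set Edge := {f | ∃ v ∈ (e : Sym2 ℕ), v ∈ (f : Sym2 ℕ)}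

theorem self_mem_touching (e : Edge) : e ∈ touching e := by
  obtain ⟨⟨u, v⟩, he⟩ := e
  exact ⟨u, Sym2.mem_mk_left u v, Sym2.mem_mk_left u v⟩

theorem touching_eq_union (e : Edge) {i j : ℕ} (h : (e : Sym2 ℕ) = s(i, j)) :
    touching e = star i ∪ star j := by
  ext f; simp [touching, star, h]

/-- The mean waiting time for the first edge that touches `e` (`0` if there is none). -/
noncomputable def touchingTime (μ : Measure Edge) (e : Edge) : ℝ≥0 :=
  (μ (touching e)).toNNReal⁻¹

/-- The event that `e` is present at time `touchingTime μ e`, as an isolated edge. -/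
def isolatedEvent {Ω : Type*} (μ : Measure Edge) (N : Edge → ℝ≥0 → Ω → ℕ) (e : Edge) : Set Ω :=
  {ω | 0 < N e (touchingTime μ e) ω} ∩ {ω | ∀ f ∈ touching e \ {e}, N f (touchingTime μ e) ω = 0}

theorem coe_touchingTime (μ : Measure Edge) (e : Edge) :
    (touchingTime μ e : ℝ) = (μ.real (touching e))⁻¹ := by
  rw [touchingTime, NNReal.coe_inv]; rfl

variable {Ω : Type*} [MeasurableSpace Ω] {P : Measure Ω} {μ : Measure Edge}
  {N : Edge → ℝ≥0 → Ω → ℕ}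

theorem measurableSet_isolatedEvent (hN : IsIndepPoissonFamily N (edgeRate μ) P) (e : Edge) :
    MeasurableSet (isolatedEvent μ N e) :=
  (measurableSet_lt measurable_const ((hN.poisson e).measurable _)).inter
    (measurableSet_forall_eq_zero hN _ _)

variable [IsProbabilityMeasure P]

theorem measureReal_pos_touchingTime_le (hN : IsIndepPoissonFamily N (edgeRate μ) P) (e : Edge) :
    P.real {ω | 0 < N e (touchingTime μ e) ω} ≤ μ.real {e} / μ.real (touching e) := by
  rw [measureReal_pos hN, coe_touchingTime, div_eq_mul_inv]
  have := Real.add_one_le_exp (-(edgeRate μ e * (μ.real (touching e))⁻¹ : ℝ))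
  have h : (edgeRate μ e : ℝ) = μ.real {e} := rfl
  rw [h] at this ⊢
  linarith

variable [IsFiniteMeasure μ]

/-- With $a=\mu(\mathrm{touching}\ e)>0$ and $r=\mu_e$, the probability at time $1/a$ is
$e^{-(a-r)/a}-e^{-1}=e^{-1}(e^{r/a}-1)\ge e^{-1}r/a$. -/
theorem le_measureReal_isolatedEvent (hN : IsIndepPoissonFamily N (edgeRate μ) P) (e : Edge) :
    Real.exp (-1) * (μ.real {e} / μ.real (touching e)) ≤ P.real (isolatedEvent μ N e) := by
  rw [isolatedEvent, measureReal_pos_inter_forall_eq_zero hN e, coe_touchingTime,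
    Set.insert_sdiff_singleton, Set.insert_eq_of_mem (self_mem_touching e),
    measureReal_sdiff (Set.singleton_subset_iff.2 (self_mem_touching e)) (measurableSet_singleton e)]
  rcases eq_or_ne (μ.real (touching e)) 0 with h | h
  · simp [h]
  · set a := μ.real (touching e)
    set r := μ.real {e}
    have h1 : -((a - r) * a⁻¹) = -1 + r / a := by field_simp; ring
    have h2 : -(a * a⁻¹) = -1 := by field_simp
    rw [h1, h2, Real.exp_add]
    have := Real.add_one_le_exp (r / a)
    nlinarith [Real.exp_pos (-1)]

/-- Forgetting isolation leaves the presence of two distinct edges, which is independent even at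
different times. Each presence probability exceeds the isolation probability by a factor of at most
$e$. -/
theorem measureReal_isolatedEvent_inter_le (hN : IsIndepPoissonFamily N (edgeRate μ) P)
    (e f : Edge) (hef : e ≠ f) :
    P.real (isolatedEvent μ N e ∩ isolatedEvent μ N f)
      ≤ Real.exp 1 ^ 2 * (P.real (isolatedEvent μ N e) * P.real (isolatedEvent μ N f)) := by
  have hlow : ∀ e, μ.real {e} / μ.real (touching e)
      ≤ Real.exp 1 * P.real (isolatedEvent μ N e) := by
    intro e
    have h := mul_le_mul_of_nonneg_left (le_measureReal_isolatedEvent hN e) (Real.exp_pos 1).le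
    rwa [← mul_assoc, ← Real.exp_add, add_neg_cancel, Real.exp_zero, one_mul] at h
  calc P.real (isolatedEvent μ N e ∩ isolatedEvent μ N f)
      ≤ P.real ({ω | 0 < N e (touchingTime μ e) ω} ∩ {ω | 0 < N f (touchingTime μ f) ω}) :=
        measureReal_mono (Set.inter_subset_inter Set.inter_subset_left Set.inter_subset_left)
    _ = P.real {ω | 0 < N e (touchingTime μ e) ω} * P.real {ω | 0 < N f (touchingTime μ f) ω} :=
        measureReal_pos_inter hN hef _ _
    _ ≤ (Real.exp 1 * P.real (isolatedEvent μ N e)) *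
          (Real.exp 1 * P.real (isolatedEvent μ N f)) :=
        mul_le_mul ((measureReal_pos_touchingTime_le hN e).trans (hlow e))
          ((measureReal_pos_touchingTime_le hN f).trans (hlow f)) measureReal_nonneg
          (by positivity)
    _ = _ := by ring

end Isolation

/-! ### Sums over pairs of vertices and sums over edges. -/

section PairSums

/-- A sum over ordered pairs of distinct vertices counts every edge at most twice. -/
theorem tsum_tsum_pair_le (w : Edge → ℝ≥0∞) (g : ℕ → ℕ → ℝ≥0∞)
    (hdiag : ∀ i, g i i = 0) (hle : ∀ (i j : ℕ) (e : Edge), (e : Sym2 ℕ) = s(i, j) → g i j ≤ w e) :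
    ∑' i, ∑' j, g i j ≤ 2 * ∑' e, w e := by
  let Q := {p : ℕ × ℕ // p.1 ≠ p.2}
  -- The Boolean records the order of the pair, which the edge forgets; its two values produce the
  -- factor 2.
  let φ : Q → Bool × Edge := fun p =>
    (decide (p.1.1 < p.1.2), ⟨s(p.1.1, p.1.2), by simpa using p.2⟩)
  have hφ : Function.Injective φ := by
    rintro ⟨⟨a, b⟩, hab⟩ ⟨⟨c, d⟩, hcd⟩ h
    simp only [φ, Prod.mk.injEq, Subtype.mk.injEq, Sym2.eq_iff, decide_eq_decide] at h
    suffices a = c ∧ b = d by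
      obtain ⟨rfl, rfl⟩ := this
      rfl
    change a ≠ b at hab
    change c ≠ d at hcd
    omega
  have hsupp : Function.support (fun p : ℕ × ℕ => g p.1 p.2) ⊆ {p : ℕ × ℕ | p.1 ≠ p.2} := by
    rintro ⟨i, j⟩ h hij
    change i = j at hij
    subst hij
    exact h (hdiag i)
  calc ∑' i, ∑' j, g i j = ∑' p : ℕ × ℕ, g p.1 p.2 := ENNReal.tsum_prod.symm
    _ = ∑' p : Q, g p.1.1 p.1.2 := (tsum_subtype_eq_of_support_subset hsupp).symm
    _ ≤ ∑' p : Q, w (φ p).2 := ENNReal.tsum_le_tsum fun p => hle _ _ _ rfl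
    _ ≤ ∑' x : Bool × Edge, w x.2 :=
        ENNReal.tsum_comp_le_tsum_of_injective hφ fun x : Bool × Edge => w x.2
    _ = 2 * ∑' e, w e := by
        rw [ENNReal.tsum_prod' (f := fun x : Bool × Edge => w x.2), tsum_bool, two_mul]

variable (μ : Measure Edge)

theorem measure_star (i : ℕ) : μ (star i) = ∑' j, pairMass μ i j := by
  have h : star i = ⋃ j, {e : Edge | (e : Sym2 ℕ) = s(i, j)} := by
    ext e
    simp only [star, Set.mem_ofPred_eq, Set.mem_iUnion, Sym2.mem_iff_exists]
  rw [h, measure_iUnion _ fun j => MeasurableSpace.measurableSet_top]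
  · rfl
  · intro j k hjk
    refine Set.disjoint_left.2 fun e h1 h2 => hjk ?_
    exact Sym2.congr_right.1 ((h1 : (e : Sym2 ℕ) = _).symm.trans h2)

theorem coe_vertexRate [IsFiniteMeasure μ] (i : ℕ) : (vertexRate μ i : ℝ) = μ.real (star i) := by
  rw [vertexRate, ← measure_star]; rfl

/-- Each edge lies in only two stars. Consequently only finitely many vertices have intensity above
a given level, and the expected number of occupied urns is finite. -/
theorem tsum_measure_star_ne_top [IsFiniteMeasure μ] : ∑' i, μ (star i) ≠ ∞ := by
  simp only [measure_star]
  refine ne_top_of_le_ne_top ?_ (tsum_tsum_pair_le (fun e => μ {e}) (pairMass μ) ?_ ?_)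
  · have h : ∑' e : Edge, μ {e} = μ Set.univ := by
      rw [← lintegral_one, lintegral_countable']; simp
    rw [h]
    exact ENNReal.mul_ne_top (by simp) (measure_ne_top _ _)
  · intro i
    have : {e : Edge | (e : Sym2 ℕ) = s(i, i)} = ∅ := by
      ext e
      simp only [Set.mem_ofPred_eq, Set.mem_empty_iff_false, iff_false]
      intro h
      exact e.2 (h ▸ Sym2.mk_isDiag_iff.2 rfl)
    rw [pairMass, this, measure_empty]
  · intro i j e he
    refine measure_mono fun f hf => Subtype.ext ?_
    exact (hf : (f : Sym2 ℕ) = _).trans he.symm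

end PairSums

/-! ### Eventual connectedness forces summability. -/

section Connectivity

variable {Ω : Type*} {N : Edge → ℝ≥0 → Ω → ℕ} {t : ℝ≥0} {ω : Ω}

/-- If an edge is isolated in a connected graph, then it is the only edge. -/
theorem eq_of_connected_of_isolated (hconn : (graphAt N t ω).Connected) {e f : Edge}
    (he : 0 < N e t ω) (hiso : ∀ g ∈ touching e \ {e}, N g t ω = 0) (hf : 0 < N f t ω) :
    f = e := by
  have honly : ∀ g ∈ touching e, 0 < N g t ω → g = e := by
    intro g hg hpos
    by_contra hne
    exact hpos.ne' (hiso g ⟨hg, hne⟩)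
  obtain ⟨⟨u, v⟩, hed⟩ := e
  obtain ⟨⟨x, y⟩, hfd⟩ := f
  set e : Edge := ⟨s(u, v), hed⟩ with hedef
  set f : Edge := ⟨s(x, y), hfd⟩ with hfdef
  have hu : u ∈ (graphAt N t ω).verts := ⟨e, he, Sym2.mem_mk_left u v⟩
  have hx : x ∈ (graphAt N t ω).verts := ⟨f, hf, Sym2.mem_mk_left x y⟩
  have hreach := hconn.coe.preconnected ⟨u, hu⟩ ⟨x, hx⟩
  -- A walk starting at an endpoint of `e` can only traverse `e`, so it never leaves its endpoints.
  have hclosed : ∀ a b : (graphAt N t ω).verts, (graphAt N t ω).coe.Reachable a b →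
      (a : ℕ) ∈ (e : Sym2 ℕ) → (b : ℕ) ∈ (e : Sym2 ℕ) := by
    rintro a b ⟨w⟩
    induction w with
    | nil => exact id
    | cons h _ ih =>
      intro ha
      refine ih ?_
      obtain ⟨g, hg, hgeq⟩ := h
      have hge : g = e := honly g ⟨_, ha, hgeq ▸ Sym2.mem_mk_left _ _⟩ hg
      rw [← hge, hgeq]
      exact Sym2.mem_mk_right _ _
  have hxe := hclosed _ _ hreach (Sym2.mem_mk_left u v)
  exact honly f ⟨x, hxe, Sym2.mem_mk_left x y⟩ hf

variable {μ : Measure Edge}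

/-- At the later of the two touching times the other edge is still present, because paths are
monotone, and would violate the isolation if it shared a vertex. -/
theorem pairwiseDisjoint_of_mem_isolatedEvent (hmono : ∀ e, Monotone fun t => N e t ω) {e f : Edge}
    (he : ω ∈ isolatedEvent μ N e) (hf : ω ∈ isolatedEvent μ N f) {v : ℕ}
    (hve : v ∈ (e : Sym2 ℕ)) (hvf : v ∈ (f : Sym2 ℕ)) : e = f := by
  wlog h : touchingTime μ e ≤ touchingTime μ f generalizing e f
  · exact (this hf he hvf hve (le_of_not_ge h)).symm
  by_contra hne
  have h0 := hf.2 e ⟨⟨v, hvf, hve⟩, hne⟩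
  exact (lt_of_lt_of_le he.1 (hmono e h)).ne' h0

theorem measure_touching_le (e : Edge) {ε : ℝ≥0∞} (h : ∀ v ∈ (e : Sym2 ℕ), μ (star v) ≤ ε) :
    μ (touching e) ≤ 2 * ε := by
  obtain ⟨⟨u, v⟩, hed⟩ := e
  rw [touching_eq_union ⟨s(u, v), hed⟩ rfl, two_mul]
  exact (measure_union_le _ _).trans
    (add_le_add (h u (Sym2.mem_mk_left u v)) (h v (Sym2.mem_mk_right u v)))

variable [MeasurableSpace Ω] {P : Measure Ω} [IsProbabilityMeasure P] [IsFiniteMeasure μ]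

/-- If the graph is eventually forever connected, then almost surely only finitely many edges are
isolated at their touching time. -/
theorem ae_finite_isolatedEvent (hN : IsIndepPoissonFamily N (edgeRate μ) P)
    (hconn : EventuallyForever (graphAt N) SimpleGraph.Subgraph.Connected P) :
    ∀ᵐ ω ∂P, {e | ω ∈ isolatedEvent μ N e}.Finite := by
  have hmono : ∀ᵐ ω ∂P, ∀ e, Monotone fun t => N e t ω :=
    ae_all_iff.2 fun e => (hN.poisson e).monotone_path
  -- Ensures that an edge isolated at its touching time has positive rate, so that this time is a
  -- genuine inverse and not the default value `0`.
  have hrate : ∀ᵐ ω ∂P, ∀ e, μ {e} = 0 → N e (touchingTime μ e) ω = 0 := by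
    refine ae_all_iff.2 fun e => ?_
    by_cases h : μ {e} = 0
    · have h1 := (measureReal_pos hN e (touchingTime μ e))
      simp only [edgeRate, h, ENNReal.toNNReal_zero, NNReal.coe_zero, zero_mul, neg_zero,
        Real.exp_zero, sub_self] at h1
      have h2 : ∀ᵐ ω ∂P, ¬ 0 < N e (touchingTime μ e) ω := by
        rw [ae_iff]
        simp only [not_not]
        exact (measureReal_eq_zero_iff (measure_ne_top _ _)).1 h1
      filter_upwards [h2] with ω hω _
      omega
    · exact ae_of_all _ fun ω h' => absurd h' h
  filter_upwards [hconn, hmono, hrate] with ω ⟨T, hT⟩ hmono hrate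
  set H := {e | ω ∈ isolatedEvent μ N e} with hH
  by_contra hinf
  -- The edges of `H` are vertex-disjoint, so the finitely many vertices of intensity at least `ε`
  -- meet only finitely many of them. Any other edge of `H` has touching mass at most `2 * ε`, hence
  -- touching time at least `3 * (T' + 1) / 2`.
  have hlate : ∀ T' : ℝ≥0, ∃ e ∈ H, T' < touchingTime μ e := by
    intro T'
    set ε : ℝ≥0∞ := (((3 * (T' + 1))⁻¹ : ℝ≥0) : ℝ≥0∞) with hε
    have hε0 : ε ≠ 0 := by
      rw [hε]; simp only [ne_eq, ENNReal.coe_eq_zero, inv_eq_zero]; positivity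
    have hW : {i | ε ≤ μ (star i)}.Finite :=
      ENNReal.finite_const_le_of_tsum_ne_top (tsum_measure_star_ne_top μ) hε0
    have hbad : (⋃ i ∈ {i | ε ≤ μ (star i)}, {e ∈ H | i ∈ (e : Sym2 ℕ)}).Finite :=
      hW.biUnion fun i _ => Set.Subsingleton.finite fun e he f hf =>
        pairwiseDisjoint_of_mem_isolatedEvent hmono he.1 hf.1 he.2 hf.2
    obtain ⟨e, heH, hegood⟩ := (Set.Infinite.sdiff hinf hbad).nonempty
    refine ⟨e, heH, ?_⟩
    have hsmall : ∀ v ∈ (e : Sym2 ℕ), μ (star v) ≤ ε := by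
      intro v hv
      by_contra hlt
      exact hegood (Set.mem_biUnion (x := v) (not_le.1 hlt).le ⟨heH, hv⟩)
    have hle : (μ (touching e)).toNNReal ≤ 2 * (3 * (T' + 1))⁻¹ := by
      rw [← ENNReal.coe_le_coe, ENNReal.coe_toNNReal (measure_ne_top _ _)]
      simpa [hε] using measure_touching_le e hsmall
    have hpos : 0 < (μ (touching e)).toNNReal := by
      refine ENNReal.toNNReal_pos (fun h0 => ?_) (measure_ne_top _ _)
      have : μ {e} = 0 :=
        measure_mono_null (Set.singleton_subset_iff.2 (self_mem_touching e)) h0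
      exact heH.1.ne' (hrate e this)
    set x := (μ (touching e)).toNNReal with hx
    rw [touchingTime, ← hx, ← one_div, lt_div_iff₀ hpos]
    rw [← div_eq_mul_inv, le_div_iff₀ (by positivity), ← NNReal.coe_le_coe] at hle
    rw [← NNReal.coe_lt_coe]
    push_cast at hle ⊢
    nlinarith [NNReal.coe_pos.2 hpos]
  -- The edge `f` persists until the later isolation of `e`; connectedness then forces `f = e`,
  -- against the strict order of their touching times.
  obtain ⟨f, hf, -⟩ := hlate 0
  obtain ⟨e, he, het⟩ := hlate (max T (touchingTime μ f))
  have hfe : f = e := eq_of_connected_of_isolated (hT _ ((le_max_left _ _).trans_lt het)) he.1 he.2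
    (lt_of_lt_of_le hf.1 (hmono f ((le_max_right _ _).trans het.le)))
  subst hfe
  exact absurd het (not_lt.2 (le_max_right _ _))

theorem summable_isolation (hN : IsIndepPoissonFamily N (edgeRate μ) P)
    (hconn : EventuallyForever (graphAt N) SimpleGraph.Subgraph.Connected P) :
    Summable fun e => μ.real {e} / μ.real (touching e) := by
  have h := summable_measureReal_of_quasiIndep P (measurableSet_isolatedEvent hN)
    (by positivity) (measureReal_isolatedEvent_inter_le hN) (ae_finite_isolatedEvent hN hconn)
  refine (summable_mul_left_iff (Real.exp_pos (-1)).ne').1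
    (Summable.of_nonneg_of_le (fun e => ?_) (le_measureReal_isolatedEvent hN) h)
  positivity

end Connectivity

end EdgeExchangeable

namespace EdgeExchangeable

/-! ### One- and two-point probabilities for vertices and urns. -/

section Inclusion

theorem setOf_mem_verticesAt {Ω : Type*} (N : Edge → ℝ≥0 → Ω → ℕ) (i : ℕ) (t : ℝ≥0) :
    {ω | i ∈ verticesAt N t ω} = {ω | ∀ e ∈ star i, N e t ω = 0}ᶜ := by
  ext ω
  simp only [verticesAt, edgesAt, star, Set.mem_ofPred_eq, Set.mem_compl_iff, not_forall,
    exists_prop, Nat.pos_iff_ne_zero]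
  exact exists_congr fun e => and_comm

variable {Ω : Type*} [MeasurableSpace Ω] {P : Measure Ω}
  {μ : Measure Edge} {N : Edge → ℝ≥0 → Ω → ℕ} {B : ℕ → ℝ≥0 → Ω → ℕ}

theorem measurableSet_mem_verticesAt (hN : IsIndepPoissonFamily N (edgeRate μ) P)
    (i : ℕ) (t : ℝ≥0) : MeasurableSet {ω | i ∈ verticesAt N t ω} := by
  rw [setOf_mem_verticesAt]
  exact (measurableSet_forall_eq_zero hN _ t).compl

theorem measurableSet_mem_occupiedUrns (hB : IsIndepPoissonFamily B (vertexRate μ) P)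
    (i : ℕ) (t : ℝ≥0) : MeasurableSet {ω | i ∈ occupiedUrns B t ω} :=
  measurableSet_lt measurable_const ((hB.poisson i).measurable t)

variable [IsProbabilityMeasure P] [IsFiniteMeasure μ]

theorem measureReal_mem_verticesAt (hN : IsIndepPoissonFamily N (edgeRate μ) P)
    (i : ℕ) (t : ℝ≥0) :
    P.real {ω | i ∈ verticesAt N t ω} = 1 - Real.exp (-(μ.real (star i) * t)) := by
  rw [setOf_mem_verticesAt, probReal_compl_eq_one_sub (measurableSet_forall_eq_zero hN _ t),
    measureReal_forall_eq_zero hN]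

theorem measureReal_mem_verticesAt_inter (hN : IsIndepPoissonFamily N (edgeRate μ) P)
    (i j : ℕ) (t : ℝ≥0) :
    P.real ({ω | i ∈ verticesAt N t ω} ∩ {ω | j ∈ verticesAt N t ω})
      = 1 - Real.exp (-(μ.real (star i) * t)) - Real.exp (-(μ.real (star j) * t))
        + Real.exp (-(μ.real (star i ∪ star j) * t)) := by
  have hm := fun i => measurableSet_forall_eq_zero hN (star i) t
  have h := measureReal_union_add_inter (μ := P) (s := {ω | ∀ e ∈ star i, N e t ω = 0}) (hm j)
  have hinter : {ω | ∀ e ∈ star i, N e t ω = 0} ∩ {ω | ∀ e ∈ star j, N e t ω = 0}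
      = {ω | ∀ e ∈ star i ∪ star j, N e t ω = 0} := by
    ext ω
    simp only [Set.mem_inter_iff, Set.mem_ofPred_eq, Set.mem_union, or_imp, forall_and]
  rw [hinter, measureReal_forall_eq_zero hN, measureReal_forall_eq_zero hN,
    measureReal_forall_eq_zero hN] at h
  rw [setOf_mem_verticesAt, setOf_mem_verticesAt, ← Set.compl_union,
    probReal_compl_eq_one_sub ((hm i).union (hm j))]
  linarith

theorem measureReal_mem_occupiedUrns (hB : IsIndepPoissonFamily B (vertexRate μ) P)
    (i : ℕ) (t : ℝ≥0) :
    P.real {ω | i ∈ occupiedUrns B t ω} = 1 - Real.exp (-(μ.real (star i) * t)) := by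
  rw [← coe_vertexRate]
  exact measureReal_pos hB i t

theorem measureReal_mem_occupiedUrns_inter (hB : IsIndepPoissonFamily B (vertexRate μ) P)
    {i j : ℕ} (hij : i ≠ j) (t : ℝ≥0) :
    P.real ({ω | i ∈ occupiedUrns B t ω} ∩ {ω | j ∈ occupiedUrns B t ω})
      = (1 - Real.exp (-(μ.real (star i) * t))) * (1 - Real.exp (-(μ.real (star j) * t))) := by
  rw [← measureReal_mem_occupiedUrns hB, ← measureReal_mem_occupiedUrns hB]
  exact measureReal_pos_inter hB hij t t

theorem tsum_measure_mem_occupiedUrns_ne_top (hB : IsIndepPoissonFamily B (vertexRate μ) P)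
    (t : ℝ≥0) : ∑' i, P {ω | i ∈ occupiedUrns B t ω} ≠ ∞ := by
  refine ne_top_of_le_ne_top (ENNReal.mul_ne_top (tsum_measure_star_ne_top μ)
    (ENNReal.coe_ne_top (r := t))) ?_
  rw [← ENNReal.tsum_mul_right]
  refine ENNReal.tsum_le_tsum fun i => ?_
  rw [← ENNReal.toReal_le_toReal (measure_ne_top _ _)
    (ENNReal.mul_ne_top (measure_ne_top _ _) ENNReal.coe_ne_top), ENNReal.toReal_mul]
  change P.real _ ≤ μ.real (star i) * (t : ℝ)
  rw [measureReal_mem_occupiedUrns hB]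
  linarith [Real.add_one_le_exp (-(μ.real (star i) * t))]

theorem tsum_measure_mem_occupiedUrns_inter_ne_top
    (hB : IsIndepPoissonFamily B (vertexRate μ) P) (t : ℝ≥0) :
    ∑' i, ∑' j, P ({ω | i ∈ occupiedUrns B t ω} ∩ {ω | j ∈ occupiedUrns B t ω}) ≠ ∞ := by
  classical
  have hs := tsum_measure_mem_occupiedUrns_ne_top hB t
  set s := ∑' i, P {ω | i ∈ occupiedUrns B t ω} with hsdef
  refine ne_top_of_le_ne_top (ENNReal.add_ne_top.2 ⟨hs, ENNReal.mul_ne_top hs hs⟩) ?_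
  have hle : ∀ i j, P ({ω | i ∈ occupiedUrns B t ω} ∩ {ω | j ∈ occupiedUrns B t ω})
      ≤ (if j = i then P {ω | i ∈ occupiedUrns B t ω} else 0)
        + P {ω | i ∈ occupiedUrns B t ω} * P {ω | j ∈ occupiedUrns B t ω} := by
    intro i j
    split_ifs with h
    · exact (measure_mono Set.inter_subset_left).trans le_self_add
    · rw [zero_add, ← ENNReal.toReal_le_toReal (measure_ne_top _ _)
        (ENNReal.mul_ne_top (measure_ne_top _ _) (measure_ne_top _ _)), ENNReal.toReal_mul]
      exact (measureReal_pos_inter hB (Ne.symm h) t t).le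
  calc _ ≤ ∑' i, ∑' j, ((if j = i then P {ω | i ∈ occupiedUrns B t ω} else 0)
        + P {ω | i ∈ occupiedUrns B t ω} * P {ω | j ∈ occupiedUrns B t ω}) :=
        ENNReal.tsum_le_tsum fun i => ENNReal.tsum_le_tsum fun j => hle i j
    _ = s + s * s := by
        simp only [ENNReal.tsum_add, tsum_ite_eq, ENNReal.tsum_mul_left, ENNReal.tsum_mul_right,
          ← hsdef]

end Inclusion

/-! ### Covariances of vertices and comparison of the variances. -/

section Comparison

variable (μ : Measure Edge)

/-- The covariance of the events that `i` and `j` are vertices of the graph at time `t`, for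
`i ≠ j`. -/
noncomputable def vertexCov (t : ℝ≥0) (i j : ℕ) : ℝ≥0∞ :=
  if i = j then 0 else ENNReal.ofReal (Real.exp (-(μ.real (star i ∪ star j) * t))
    - Real.exp (-(μ.real (star i) * t)) * Real.exp (-(μ.real (star j) * t)))

variable [IsFiniteMeasure μ]

/-- The two stars meet only in `e`, so their masses add up to $a+r$ with $a=\mu(\mathrm{touching}\
e)$ and $r=\mu_e$. The covariance is therefore $e^{-at}(1-e^{-rt})\le (r/a)\,(at\,e^{-at})\le r/a$
when $a>0$, whatever $t$ is. -/
theorem vertexCov_le (t : ℝ≥0) (i j : ℕ) (e : Edge) (he : (e : Sym2 ℕ) = s(i, j)) :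
    vertexCov μ t i j ≤ ENNReal.ofReal (μ.real {e} / μ.real (touching e)) := by
  have hij : i ≠ j := fun h => e.2 (he ▸ Sym2.mk_isDiag_iff.2 h)
  have hinter : star i ∩ star j = {e} := by
    ext f
    simp only [star, Set.mem_inter_iff, Set.mem_ofPred_eq, Set.mem_singleton_iff]
    rw [Sym2.mem_and_mem_iff hij, ← he, Subtype.ext_iff]
  have hadd := measureReal_union_add_inter (μ := μ) (s := star i) (t := star j)
    MeasurableSpace.measurableSet_top
  rw [vertexCov, if_neg hij]
  refine ENNReal.ofReal_le_ofReal ?_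
  rw [hinter, ← touching_eq_union e he] at hadd
  rw [← touching_eq_union e he, ← Real.exp_add, ← neg_add, ← add_mul, ← hadd]
  set a := μ.real (touching e)
  set r := μ.real {e}
  have hr0 : 0 ≤ r := measureReal_nonneg
  have hra : r ≤ a := measureReal_mono (Set.singleton_subset_iff.2 (self_mem_touching e))
  rcases (hr0.trans hra).eq_or_lt with h | h
  · have : r = 0 := le_antisymm (h ▸ hra) hr0
    simp [this]
  · rw [le_div_iff₀ h, show -((a + r) * (t : ℝ)) = -(a * t) + -(r * t) by ring, Real.exp_add]
    have h1 := Real.add_one_le_exp (-(r * (t : ℝ)))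
    have h2 : a * t * Real.exp (-(a * t)) ≤ 1 := by
      rw [Real.exp_neg, ← div_eq_mul_inv, div_le_one (Real.exp_pos _)]
      linarith [Real.add_one_le_exp (a * (t : ℝ))]
    have h3 := Real.exp_pos (-(a * (t : ℝ)))
    calc (Real.exp (-(a * t)) - Real.exp (-(a * t)) * Real.exp (-(r * t))) * a
        = (1 - Real.exp (-(r * t))) * (a * Real.exp (-(a * t))) := by ring
      _ ≤ (r * t) * (a * Real.exp (-(a * t))) := by gcongr; linarith
      _ = r * (a * t * Real.exp (-(a * t))) := by ring
      _ ≤ r * 1 := by gcongr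
      _ = r := mul_one r

theorem tsum_vertexCov_le (t : ℝ≥0) :
    ∑' i, ∑' j, vertexCov μ t i j
      ≤ 2 * ∑' e, ENNReal.ofReal (μ.real {e} / μ.real (touching e)) :=
  tsum_tsum_pair_le _ _ (fun i => by simp [vertexCov]) (vertexCov_le μ t)

variable {μ}
variable {Ω : Type*} [MeasurableSpace Ω] {P : Measure Ω} [IsProbabilityMeasure P]
  {N : Edge → ℝ≥0 → Ω → ℕ} {Ω' : Type*} [MeasurableSpace Ω'] {P' : Measure Ω'}
  [IsProbabilityMeasure P'] {B : ℕ → ℝ≥0 → Ω' → ℕ}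

theorem measure_mem_verticesAt_eq (hN : IsIndepPoissonFamily N (edgeRate μ) P)
    (hB : IsIndepPoissonFamily B (vertexRate μ) P') (t : ℝ≥0) (i : ℕ) :
    P {ω | i ∈ verticesAt N t ω} = P' {ω | i ∈ occupiedUrns B t ω} := by
  rw [← ENNReal.toReal_eq_toReal_iff' (measure_ne_top _ _) (measure_ne_top _ _)]
  exact (measureReal_mem_verticesAt hN i t).trans (measureReal_mem_occupiedUrns hB i t).symm

/-- Subadditivity of `μ` makes the covariance nonnegative, so `ENNReal.ofReal` truncates nothing and
the identity can be summed in `ℝ≥0∞`. On the diagonal both sides are one-point probabilities. -/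
theorem measure_mem_verticesAt_inter_eq (hN : IsIndepPoissonFamily N (edgeRate μ) P)
    (hB : IsIndepPoissonFamily B (vertexRate μ) P') (t : ℝ≥0) (i j : ℕ) :
    P ({ω | i ∈ verticesAt N t ω} ∩ {ω | j ∈ verticesAt N t ω})
      = P' ({ω | i ∈ occupiedUrns B t ω} ∩ {ω | j ∈ occupiedUrns B t ω})
        + vertexCov μ t i j := by
  rw [vertexCov]
  split_ifs with h
  · subst h
    simpa using measure_mem_verticesAt_eq hN hB t i
  · have hnonneg : 0 ≤ Real.exp (-(μ.real (star i ∪ star j) * t))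
        - Real.exp (-(μ.real (star i) * t)) * Real.exp (-(μ.real (star j) * t)) := by
      rw [sub_nonneg, ← Real.exp_add, ← neg_add, ← add_mul]
      gcongr
      exact measureReal_union_le _ _
    rw [← ENNReal.toReal_eq_toReal_iff' (measure_ne_top _ _)
      (ENNReal.add_ne_top.2 ⟨measure_ne_top _ _, ENNReal.ofReal_ne_top⟩),
      ENNReal.toReal_add (measure_ne_top _ _) ENNReal.ofReal_ne_top,
      ENNReal.toReal_ofReal hnonneg]
    change P.real _ = P'.real _ + _
    rw [measureReal_mem_verticesAt_inter hN, measureReal_mem_occupiedUrns_inter hB h]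
    ring

/-- The variances of the numbers of vertices and of occupied urns differ by the sum of the
covariances between distinct vertices. -/
theorem cardVariance_verticesAt_eq (hN : IsIndepPoissonFamily N (edgeRate μ) P)
    (hB : IsIndepPoissonFamily B (vertexRate μ) P') {t : ℝ≥0}
    (hcov : ∑' i, ∑' j, vertexCov μ t i j ≠ ∞) :
    cardVariance (verticesAt N t) P
      = cardVariance (occupiedUrns B t) P' + (∑' i, ∑' j, vertexCov μ t i j).toReal := by
  have h1 := tsum_measure_mem_occupiedUrns_ne_top hB t
  have h2 := tsum_measure_mem_occupiedUrns_inter_ne_top hB t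
  have e1 : ∑' i, P {ω | i ∈ verticesAt N t ω} = ∑' i, P' {ω | i ∈ occupiedUrns B t ω} :=
    tsum_congr fun i => measure_mem_verticesAt_eq hN hB t i
  have e2 : ∑' i, ∑' j, P ({ω | i ∈ verticesAt N t ω} ∩ {ω | j ∈ verticesAt N t ω})
      = (∑' i, ∑' j, P' ({ω | i ∈ occupiedUrns B t ω} ∩ {ω | j ∈ occupiedUrns B t ω}))
        + ∑' i, ∑' j, vertexCov μ t i j := by
    simp only [measure_mem_verticesAt_inter_eq hN hB, ENNReal.tsum_add]
  rw [cardVariance_eq P (fun i => measurableSet_mem_verticesAt hN i t) (e1 ▸ h1)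
      (e2 ▸ ENNReal.add_ne_top.2 ⟨h2, hcov⟩),
    cardVariance_eq P' (fun i => measurableSet_mem_occupiedUrns hB i t) h1 h2, e1, e2,
    ENNReal.toReal_add h2 hcov]
  ring

end Comparison

end EdgeExchangeable

/-! ### From a bounded difference to the ratio of variances. -/

/-- Two functions whose difference is nonnegative and bounded tend to infinity together, and are
then asymptotically equal. -/
theorem tendsto_atTop_and_div_of_bounded_sub {α : Type*} {l : Filter α} {u v d : α → ℝ} {C : ℝ}
    (hv : ∀ t, v t = u t + d t) (hd : ∀ t, 0 ≤ d t) (hC : ∀ t, d t ≤ C)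
    (h : Tendsto u l atTop ∨ Tendsto v l atTop) :
    Tendsto u l atTop ∧ Tendsto v l atTop ∧ Tendsto (fun t => v t / u t) l (𝓝 1) := by
  have hu : Tendsto u l atTop := by
    refine h.elim id fun h => ?_
    refine tendsto_atTop_mono (fun t => ?_) (tendsto_atTop_add_const_right l (-C) h)
    linarith [hv t, hC t]
  refine ⟨hu, tendsto_atTop_mono (fun t => by linarith [hv t, hd t]) hu, ?_⟩
  have hratio : Tendsto (fun t => d t / u t) l (𝓝 0) := by
    refine tendsto_of_tendsto_of_tendsto_of_le_of_le' tendsto_const_nhds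
      (hu.const_div_atTop C) ?_ ?_
    · filter_upwards [hu.eventually_gt_atTop 0] with t ht
      exact div_nonneg (hd t) ht.le
    · filter_upwards [hu.eventually_gt_atTop 0] with t ht
      exact div_le_div_of_nonneg_right (hC t) ht.le
  have hlim := hratio.const_add 1
  rw [add_zero] at hlim
  refine hlim.congr' ?_
  filter_upwards [hu.eventually_gt_atTop 0] with t ht
  rw [hv t, add_div, div_self ht.ne']

theorem mainTheorem9
    (μ : Measure EdgeExchangeable.Edge) [IsFiniteMeasure μ]
    {Ω : Type*} [MeasurableSpace Ω] (P : Measure Ω) [IsProbabilityMeasure P]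
    (N : EdgeExchangeable.Edge → ℝ≥0 → Ω → ℕ)
    (hN : EdgeExchangeable.IsIndepPoissonFamily N (EdgeExchangeable.edgeRate μ) P)
    {Ω' : Type*} [MeasurableSpace Ω'] (P' : Measure Ω') [IsProbabilityMeasure P']
    (B : ℕ → ℝ≥0 → Ω' → ℕ)
    (hB : EdgeExchangeable.IsIndepPoissonFamily B (EdgeExchangeable.vertexRate μ) P')
    (hconn : EdgeExchangeable.EventuallyForever (EdgeExchangeable.graphAt N)
      SimpleGraph.Subgraph.Connected P)
    (hvar :
      Tendsto (fun t => EdgeExchangeable.cardVariance (EdgeExchangeable.occupiedUrns B t) P')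
        atTop atTop ∨
      Tendsto (fun t => EdgeExchangeable.cardVariance (EdgeExchangeable.verticesAt N t) P)
        atTop atTop) :
    Tendsto (fun t => EdgeExchangeable.cardVariance (EdgeExchangeable.occupiedUrns B t) P')
        atTop atTop ∧
      Tendsto (fun t => EdgeExchangeable.cardVariance (EdgeExchangeable.verticesAt N t) P)
        atTop atTop ∧
      Tendsto (fun t => EdgeExchangeable.cardVariance (EdgeExchangeable.verticesAt N t) P /
          EdgeExchangeable.cardVariance (EdgeExchangeable.occupiedUrns B t) P')
        atTop (𝓝 1) := by
  -- This time-independent quantity bounds the difference of the variances.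
  have hfin : 2 * ∑' e, ENNReal.ofReal (μ.real {e} / μ.real (EdgeExchangeable.touching e)) ≠ ∞ :=
    ENNReal.mul_ne_top (by simp) (EdgeExchangeable.summable_isolation hN hconn).tsum_ofReal_ne_top
  have hcov : ∀ t, ∑' i, ∑' j, EdgeExchangeable.vertexCov μ t i j ≠ ∞ := fun t =>
    ne_top_of_le_ne_top hfin (EdgeExchangeable.tsum_vertexCov_le μ t)
  exact tendsto_atTop_and_div_of_bounded_sub
    (fun t => EdgeExchangeable.cardVariance_verticesAt_eq hN hB (hcov t))
    (fun t => ENNReal.toReal_nonneg)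
    (fun t => ENNReal.toReal_mono hfin (EdgeExchangeable.tsum_vertexCov_le μ t)) hvar
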